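/- Let $N\ge 5$ be an integer, let $\alpha\in\mathbb C$, and let $\alpha^{1/N}$ denote any fixed $N$-th root of $\alpha$. Let $(\xi_j)_{j\ge 1}$ be independent complex random variables on a probability space $(\Omega,\mathcal F,\mathbb P)$, each with the uniform distribution on the points $\alpha^{1/N}e^{2\pi i k/N}$, $k=0,\dots,N-1$, i.e. $\mathbb E[f(\xi_j)]=\frac1N\sum_{k=0}^{N-1} f(\alpha^{1/N}e^{2\pi i k/N})$, and let $S_n=\sum_{j=1}^n \xi_j$. Then the random walk $(S_n)$ is neighborhood-recurrent: for every $x$ in the lattice generated by these points (the additive subgroup of $\mathbb C$ consisting of all their integer linear combinations) and for every $\varepsilon>0$, $$\mathbb P\big(|S_n-x|\le\varepsilon\ \text{for infinitely many } n\big)=1 .$$ -/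

import Mathlib

open MeasureTheory ProbabilityTheory Filter
open scoped ENNReal

noncomputable section

/-- The point `a * e^{2πik/N}`; with `a ^ N = α` these are the points of `α^{1/N} R(N)`, where
`R(N)` is the set of `N`-th roots of unity. -/
def stepPoint (N : ℕ) (a : ℂ) (k : ℕ) : ℂ :=
  a * Complex.exp (2 * Complex.I * Real.pi * k / N)

/-- The uniform law on the points `a * e^{2πik/N}`, `k = 0, …, N - 1`: mass `1 / N` at each, so that
`E[f(ξ)] = (1/N) ∑ k, f (a * e^{2πik/N})`. -/
def stepLaw (N : ℕ) (a : ℂ) : Measure ℂ :=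
  (N : ℝ≥0∞)⁻¹ • ∑ k ∈ Finset.range N, Measure.dirac (stepPoint N a k)

/-- The lattice generated by the points `a * e^{2πik/N}`, `k = 0, …, N - 1`: all their integer linear
combinations. -/
def stepLattice (N : ℕ) (a : ℂ) : AddSubgroup ℂ :=
  AddSubgroup.closure {z | ∃ k < N, z = stepPoint N a k}

/-- The random walk with steps `ξ 0, ξ 1, …`: the position after `n` steps. -/
def walk {Ω : Type*} (ξ : ℕ → Ω → ℂ) (n : ℕ) (ω : Ω) : ℂ :=
  ∑ j ∈ Finset.range n, ξ j ω

end

/-!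
The walk is recurrent because of a Lyapunov function. Write `stepMean` for the average over one step
of the walk, and take first `a = 1`. Since the product of the `y + e^{2πik/N}` is `y ^ N - (-1) ^ N`,
the function `log ‖y‖²` is preserved by `stepMean` up to an error `O(‖y‖ ^ (-N))`
(`stepMean_log_le`). As the steps have mean `0` and covariance half the identity, `‖y‖⁻²` grows on
average by `‖y‖⁻⁴ + O(‖y‖⁻⁵)` (`le_stepMean_inv_norm_sq`). For `N ≥ 5` the second effect dominates,
so `log ‖y‖² - ‖y‖⁻²` tends to infinity and strictly decreases on average off the disc of radius
`100` (`stepMean_logPotential_le`). By `neverProb_eq_zero_of_lyapunov` the walk then visits this disc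
almost surely, from wherever it starts: to avoid it, the walk would have to reach a high level of the
Lyapunov function, which is unlikely, or to stay for ever in a region with a uniform negative drift,
which is impossible. A general `a ≠ 0` follows by scaling.

In the disc, the walk started in the lattice reaches a given ball around a lattice point `x` with
probability bounded below: any two lattice points are joined by a finite list of steps, and by total
boundedness finitely many lists serve all lattice points of the disc. So the supremum `s` over the
lattice of the probability of never visiting the ball satisfies `s ≤ s * c` with `c < 1`, and `s = 0`
(`neverProb_closedBall_eq_zero`).

These arguments concern `avoidProb`, the avoidance probabilities defined by recursion on the first
step. They are identified with probabilities of events in `pathLaw_avoidEvent_zero`, and the Markov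
property at a time `m` (`tendsto_pathLaw_avoidEvent`) shows that the ball is almost surely visited
after time `m`, for every `m`.
-/

/-! ### Averaging over one step and avoidance probabilities -/

/-- The transition operator of the walk: the mean of `g` after one step from `y`. -/
noncomputable def stepMean (N : ℕ) (a : ℂ) (g : ℂ → ℝ) (y : ℂ) : ℝ :=
  (N : ℝ)⁻¹ * ∑ k ∈ Finset.range N, g (y + stepPoint N a k)

open Classical in
/-- The probability that the walk started at `y` avoids `B` at all times `0, …, n`, defined by
conditioning on the first step. -/
noncomputable def avoidProb (N : ℕ) (a : ℂ) (B : Set ℂ) : ℕ → ℂ → ℝ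
  | 0, y => if y ∈ B then 0 else 1
  | n + 1, y => if y ∈ B then 0 else stepMean N a (avoidProb N a B n) y

section StepMean

variable {N : ℕ} {a : ℂ}

lemma stepMean_mono {g h : ℂ → ℝ} {y : ℂ}
    (hgh : ∀ k < N, g (y + stepPoint N a k) ≤ h (y + stepPoint N a k)) :
    stepMean N a g y ≤ stepMean N a h y := by
  unfold stepMean
  gcongr with k hk
  exact hgh k (Finset.mem_range.1 hk)

lemma stepMean_const (hN : 0 < N) (c : ℝ) (y : ℂ) : stepMean N a (fun _ => c) y = c := by
  have : (N : ℝ) ≠ 0 := by positivity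
  simp [stepMean, this]

lemma stepMean_const_mul (c : ℝ) (g : ℂ → ℝ) (y : ℂ) :
    stepMean N a (fun z => c * g z) y = c * stepMean N a g y := by
  simp only [stepMean, ← Finset.mul_sum]
  ring

lemma stepMean_add (g h : ℂ → ℝ) (y : ℂ) :
    stepMean N a (fun z => g z + h z) y = stepMean N a g y + stepMean N a h y := by
  simp only [stepMean, Finset.sum_add_distrib]
  ring

end StepMean

section AvoidProb

variable {N : ℕ} {a : ℂ} {B : Set ℂ}

lemma avoidProb_of_mem {y : ℂ} (hy : y ∈ B) (n : ℕ) : avoidProb N a B n y = 0 := by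
  cases n <;> simp [avoidProb, hy]

lemma avoidProb_zero_of_notMem {y : ℂ} (hy : y ∉ B) : avoidProb N a B 0 y = 1 := by
  simp [avoidProb, hy]

lemma avoidProb_succ_of_notMem {y : ℂ} (hy : y ∉ B) (n : ℕ) :
    avoidProb N a B (n + 1) y = stepMean N a (avoidProb N a B n) y := by
  simp [avoidProb, hy]

lemma avoidProb_nonneg (n : ℕ) (y : ℂ) : 0 ≤ avoidProb N a B n y := by
  induction n generalizing y with
  | zero => by_cases hy : y ∈ B <;> simp [avoidProb, hy]
  | succ n ih =>
    by_cases hy : y ∈ B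
    · simp [avoidProb, hy]
    · rw [avoidProb_succ_of_notMem hy]
      exact mul_nonneg (by positivity) (Finset.sum_nonneg fun k _ => ih _)

lemma avoidProb_le_one (hN : 0 < N) (n : ℕ) (y : ℂ) : avoidProb N a B n y ≤ 1 := by
  induction n generalizing y with
  | zero => by_cases hy : y ∈ B <;> simp [avoidProb, hy]
  | succ n ih =>
    by_cases hy : y ∈ B
    · simp [avoidProb, hy]
    · rw [avoidProb_succ_of_notMem hy]
      exact (stepMean_mono fun k _ => ih _).trans_eq (stepMean_const hN 1 y)

lemma avoidProb_succ_le_stepMean (n : ℕ) (y : ℂ) :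
    avoidProb N a B (n + 1) y ≤ stepMean N a (avoidProb N a B n) y := by
  by_cases hy : y ∈ B
  · rw [avoidProb_of_mem hy]
    exact mul_nonneg (by positivity) (Finset.sum_nonneg fun k _ => avoidProb_nonneg _ _)
  · rw [avoidProb_succ_of_notMem hy]

lemma avoidProb_antitone (hN : 0 < N) (y : ℂ) : Antitone fun n => avoidProb N a B n y := by
  refine antitone_nat_of_succ_le fun n => ?_
  induction n generalizing y with
  | zero =>
    by_cases hy : y ∈ B
    · simp [avoidProb_of_mem hy]
    · rw [avoidProb_zero_of_notMem hy]
      exact avoidProb_le_one hN _ _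
  | succ n ih =>
    by_cases hy : y ∈ B
    · simp [avoidProb_of_mem hy]
    · rw [avoidProb_succ_of_notMem hy, avoidProb_succ_of_notMem hy]
      exact stepMean_mono fun k _ => ih _

/-- The probability that the walk started at `y` never visits `B`, as the infimum (and limit) of the
avoidance probabilities, which decrease in the time horizon. -/
noncomputable def neverProb (N : ℕ) (a : ℂ) (B : Set ℂ) (y : ℂ) : ℝ :=
  ⨅ n, avoidProb N a B n y

lemma bddBelow_avoidProb (y : ℂ) : BddBelow (Set.range fun n => avoidProb N a B n y) :=
  ⟨0, by rintro _ ⟨n, rfl⟩; exact avoidProb_nonneg n y⟩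

lemma tendsto_avoidProb (hN : 0 < N) (y : ℂ) :
    Tendsto (fun n => avoidProb N a B n y) atTop (nhds (neverProb N a B y)) :=
  tendsto_atTop_ciInf (avoidProb_antitone hN y) (bddBelow_avoidProb y)

lemma neverProb_le_avoidProb (n : ℕ) (y : ℂ) : neverProb N a B y ≤ avoidProb N a B n y :=
  ciInf_le (bddBelow_avoidProb y) n

lemma neverProb_nonneg (y : ℂ) : 0 ≤ neverProb N a B y :=
  le_ciInf fun n => avoidProb_nonneg n y

lemma neverProb_le_one (hN : 0 < N) (y : ℂ) : neverProb N a B y ≤ 1 :=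
  (neverProb_le_avoidProb 0 y).trans (avoidProb_le_one hN 0 y)

lemma neverProb_of_mem {y : ℂ} (hy : y ∈ B) : neverProb N a B y = 0 := by
  simp [neverProb, avoidProb_of_mem hy]

lemma neverProb_le_stepMean (hN : 0 < N) (y : ℂ) :
    neverProb N a B y ≤ stepMean N a (neverProb N a B) y := by
  have h1 : Tendsto (fun n => stepMean N a (avoidProb N a B n) y) atTop
      (nhds (stepMean N a (neverProb N a B) y)) :=
    (tendsto_finsetSum _ fun k _ => tendsto_avoidProb hN _).const_mul _
  exact ge_of_tendsto h1 (Eventually.of_forall fun n =>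
    (neverProb_le_avoidProb (n + 1) y).trans (avoidProb_succ_le_stepMean n y))

end AvoidProb

/-! ### A Lyapunov criterion for almost sure hitting -/

section Lyapunov

variable {N : ℕ} {a : ℂ} {A : Set ℂ} {f : ℂ → ℝ}

/-- A nonnegative function that drops by `η` on average off `A` bounds the mean hitting time of `A`
by `f / η`; this is the resulting Markov-type bound. -/
lemma avoidProb_mul_le_of_drift (hN : 0 < N) {η : ℝ} (hη : 0 ≤ η) (hf : ∀ x, 0 ≤ f x)
    (hdrift : ∀ x, x ∉ A → stepMean N a f x ≤ f x - η) (n : ℕ) (x : ℂ) :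
    avoidProb N a A n x * (n * η) ≤ f x := by
  induction n generalizing x with
  | zero => simpa using hf x
  | succ n ih =>
    by_cases hx : x ∈ A
    · simpa [avoidProb_of_mem hx] using hf x
    · have h1 : stepMean N a (fun z => (n * η) * avoidProb N a A n z) x ≤ stepMean N a f x :=
        stepMean_mono fun k _ => by rw [mul_comm]; exact ih _
      rw [stepMean_const_mul, ← avoidProb_succ_of_notMem hx] at h1
      have h2 : avoidProb N a A (n + 1) x * η ≤ 1 * η :=
        mul_le_mul_of_nonneg_right (avoidProb_le_one hN _ _) hη
      have := hdrift x hx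
      push_cast
      nlinarith

/-- A walk that avoids `A` either leaves the sublevel set `{f < M}`, which has probability at most
`f / M` since `f` is superharmonic off `A`, or stays in `{f < M}` off `A`. -/
lemma avoidProb_le_of_superharmonic (hN : 0 < N) {M : ℝ} (hM : 0 < M) (hf : ∀ x, 0 ≤ f x)
    (hsuper : ∀ x, x ∉ A → stepMean N a f x ≤ f x) (n : ℕ) (x : ℂ) :
    avoidProb N a A n x ≤ M⁻¹ * f x + avoidProb N a {x | x ∉ A → M ≤ f x} n x := by
  have hf' : ∀ x, 0 ≤ M⁻¹ * f x := fun x => mul_nonneg (by positivity) (hf x)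
  induction n generalizing x with
  | zero =>
    by_cases hx : x ∈ A
    · rw [avoidProb_of_mem hx]
      exact add_nonneg (hf' x) (avoidProb_nonneg _ _)
    by_cases hx' : M ≤ f x
    · have : 1 ≤ M⁻¹ * f x := by rw [inv_mul_eq_div, one_le_div hM]; exact hx'
      exact (avoidProb_le_one hN _ _).trans (this.trans
        (le_add_of_nonneg_right (avoidProb_nonneg _ _)))
    · rw [avoidProb_zero_of_notMem hx, avoidProb_zero_of_notMem (by simp [hx, hx'])]
      linarith [hf' x]
  | succ n ih =>
    by_cases hx : x ∈ A
    · rw [avoidProb_of_mem hx]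
      exact add_nonneg (hf' x) (avoidProb_nonneg _ _)
    by_cases hx' : M ≤ f x
    · have : 1 ≤ M⁻¹ * f x := by rw [inv_mul_eq_div, one_le_div hM]; exact hx'
      exact (avoidProb_le_one hN _ _).trans (this.trans
        (le_add_of_nonneg_right (avoidProb_nonneg _ _)))
    · rw [avoidProb_succ_of_notMem hx,
        avoidProb_succ_of_notMem (B := {x | x ∉ A → M ≤ f x}) (by simp [hx, hx'])]
      -- Here `x` lies in `{f < M}` off `A`, so both avoidance probabilities average over one step.
      refine (stepMean_mono (h := fun z => M⁻¹ * f z + avoidProb N a {x | x ∉ A → M ≤ f x} n z)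
        fun k _ => ih _).trans ?_
      rw [stepMean_add, stepMean_const_mul]
      gcongr
      exact hsuper x hx

/-- If `f ≥ 0` is superharmonic off `A`, with a drift bounded away from `0` on each sublevel set,
then the walk visits `A` almost surely. -/
theorem neverProb_eq_zero_of_lyapunov (hN : 0 < N) (hf : ∀ x, 0 ≤ f x)
    (hsuper : ∀ x, x ∉ A → stepMean N a f x ≤ f x)
    (hdrift : ∀ M, ∃ η > 0, ∀ x, x ∉ A → f x < M → stepMean N a f x ≤ f x - η) (x : ℂ) :
    neverProb N a A x = 0 := by
  have key : ∀ M : ℝ, 0 < M → neverProb N a A x ≤ M⁻¹ * f x := by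
    intro M hM
    obtain ⟨η, hη, hd⟩ := hdrift M
    set B : Set ℂ := {x | x ∉ A → M ≤ f x} with hB
    have h1 : ∀ n : ℕ, 1 ≤ n → neverProb N a A x ≤ M⁻¹ * f x + f x / η * (n : ℝ)⁻¹ := by
      intro n hn
      have hn' : (0 : ℝ) < n := by exact_mod_cast hn
      have h2 := avoidProb_mul_le_of_drift (A := B) (a := a) hN hη.le hf (fun y hy => by
        simp only [hB, Set.mem_ofPred_eq, Classical.not_imp, not_le] at hy
        exact hd y hy.1 hy.2) n x
      have h3 : avoidProb N a B n x ≤ f x / η * (n : ℝ)⁻¹ := by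
        rw [← div_eq_mul_inv, div_div, le_div_iff₀ (by positivity), mul_comm η]
        exact h2
      exact (neverProb_le_avoidProb n x).trans
        ((avoidProb_le_of_superharmonic hN hM hf hsuper n x).trans (by gcongr))
    have h4 : Tendsto (fun n : ℕ => M⁻¹ * f x + f x / η * (n : ℝ)⁻¹) atTop
        (nhds (M⁻¹ * f x + f x / η * 0)) :=
      (tendsto_inv_atTop_nhds_zero_nat.const_mul _).const_add _
    rw [mul_zero, add_zero] at h4
    exact ge_of_tendsto h4 (eventually_atTop.2 ⟨1, h1⟩)
  have h5 : Tendsto (fun M : ℝ => M⁻¹ * f x) atTop (nhds (0 * f x)) :=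
    tendsto_inv_atTop_zero.mul_const _
  rw [zero_mul] at h5
  exact le_antisymm (ge_of_tendsto h5 ((eventually_gt_atTop 0).mono key)) (neverProb_nonneg x)

end Lyapunov

/-! ### The steps and the lattice they generate -/

section Lattice

variable {N : ℕ} {a : ℂ}

lemma stepPoint_eq_mul_pow (N : ℕ) (a : ℂ) (k : ℕ) :
    stepPoint N a k = a * Complex.exp (2 * Real.pi * Complex.I / N) ^ k := by
  rw [stepPoint, ← Complex.exp_nat_mul]
  congr 2
  ring

lemma norm_stepPoint (N : ℕ) (a : ℂ) (k : ℕ) : ‖stepPoint N a k‖ = ‖a‖ := by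
  have : 2 * Complex.I * Real.pi * k / N = ((2 * Real.pi * k / N : ℝ) : ℂ) * Complex.I := by
    push_cast; ring
  rw [stepPoint, this, norm_mul, Complex.norm_exp_ofReal_mul_I, mul_one]

lemma sum_stepPoint (hN : 2 ≤ N) (a : ℂ) : ∑ k ∈ Finset.range N, stepPoint N a k = 0 := by
  simp only [stepPoint_eq_mul_pow, ← Finset.mul_sum]
  rw [(Complex.isPrimitiveRoot_exp N (by omega)).geom_sum_eq_zero (by omega), mul_zero]

/-- Every lattice point is reachable in finitely many steps: the `N` steps add up to `0`, so the
negative of a step is the sum of the other ones. -/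
lemma exists_list_sum_stepPoint (hN : 2 ≤ N) {x : ℂ} (hx : x ∈ stepLattice N a) :
    ∃ l : List ℕ, (∀ k ∈ l, k < N) ∧ (l.map (stepPoint N a)).sum = x := by
  induction hx using AddSubgroup.closure_induction with
  | mem x hx =>
    obtain ⟨k, hk, rfl⟩ := hx
    exact ⟨[k], by simpa using hk, by simp⟩
  | zero => exact ⟨[], by simp, by simp⟩
  | add x y _ _ ihx ihy =>
    obtain ⟨l, hl, rfl⟩ := ihx
    obtain ⟨m, hm, rfl⟩ := ihy
    refine ⟨l ++ m, fun k hk => ?_, by simp⟩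
    rcases List.mem_append.1 hk with h | h
    exacts [hl k h, hm k h]
  | neg x hx ih =>
    clear hx
    obtain ⟨l, hl, rfl⟩ := ih
    induction l with
    | nil => exact ⟨[], by simp, by simp⟩
    | cons k l ih =>
      obtain ⟨m, hm, hm'⟩ := ih fun j hj => hl j (List.mem_cons_of_mem _ hj)
      have hk : k < N := hl k List.mem_cons_self
      refine ⟨((Finset.range N).erase k).toList ++ m, fun j hj => ?_, ?_⟩
      · rcases List.mem_append.1 hj with h | h
        · exact Finset.mem_range.1 (Finset.mem_of_mem_erase (Finset.mem_toList.1 h))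
        · exact hm j h
      · have h := Finset.sum_erase_add (Finset.range N) (stepPoint N a) (Finset.mem_range.2 hk)
        rw [sum_stepPoint hN] at h
        rw [List.map_append, List.sum_append, hm', Finset.sum_map_toList, List.map_cons,
          List.sum_cons]
        linear_combination h

lemma stepPoint_mem_stepLattice {k : ℕ} (hk : k < N) : stepPoint N a k ∈ stepLattice N a :=
  AddSubgroup.subset_closure ⟨k, hk, rfl⟩

/-- Following a prescribed list of steps into `B` has positive probability. -/
lemma avoidProb_length_le {B : Set ℂ} (hN : 0 < N) (l : List ℕ) (hl : ∀ k ∈ l, k < N) {y : ℂ}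
    (hy : y + (l.map (stepPoint N a)).sum ∈ B) :
    avoidProb N a B l.length y ≤ 1 - (N : ℝ)⁻¹ ^ l.length := by
  induction l generalizing y with
  | nil => simp [avoidProb_of_mem (by simpa using hy : y ∈ B)]
  | cons k l ih =>
    have hk : k ∈ Finset.range N := Finset.mem_range.2 (hl k List.mem_cons_self)
    have hN' : (N : ℝ) ≠ 0 := by positivity
    have h1 := ih (fun j hj => hl j (List.mem_cons_of_mem _ hj)) (y := y + stepPoint N a k)
      (by simpa [add_assoc] using hy)
    refine (avoidProb_succ_le_stepMean _ _).trans ?_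
    have h2 : ∑ j ∈ (Finset.range N).erase k, avoidProb N a B l.length (y + stepPoint N a j)
        ≤ ∑ j ∈ (Finset.range N).erase k, (1 : ℝ) :=
      Finset.sum_le_sum fun j _ => avoidProb_le_one hN _ _
    rw [Finset.sum_const, Finset.card_erase_of_mem hk, Finset.card_range, nsmul_eq_mul, mul_one,
      Nat.cast_sub hN, Nat.cast_one] at h2
    rw [stepMean, ← Finset.sum_erase_add _ _ hk]
    calc _ ≤ (N : ℝ)⁻¹ * ((N - 1) + (1 - (N : ℝ)⁻¹ ^ l.length)) := by gcongr
      _ = _ := by rw [List.length_cons, pow_succ]; field_simp; ring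

end Lattice

/-! ### From visiting a bounded set to visiting a small ball -/

section Recurrence

variable {N : ℕ} {a : ℂ}

/-- The Markov property at time `n`, in terms of an upper bound `s` for the probability of never
visiting `B` from a lattice point. -/
lemma neverProb_le_mul_avoidProb (hN : 0 < N) {B : Set ℂ} {s : ℝ}
    (hs : ∀ y ∈ stepLattice N a, neverProb N a B y ≤ s) (n : ℕ) :
    ∀ y ∈ stepLattice N a, neverProb N a B y ≤ s * avoidProb N a B n y := by
  induction n with
  | zero =>
    intro y hy
    by_cases hB : y ∈ B
    · simp [neverProb_of_mem hB, avoidProb_of_mem hB]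
    · simpa [avoidProb_zero_of_notMem hB] using hs y hy
  | succ n ih =>
    intro y hy
    by_cases hB : y ∈ B
    · simp [neverProb_of_mem hB, avoidProb_of_mem hB]
    · rw [avoidProb_succ_of_notMem hB, ← stepMean_const_mul]
      exact (neverProb_le_stepMean hN y).trans
        (stepMean_mono fun k hk => ih _ (add_mem hy (stepPoint_mem_stepLattice hk)))

/-- The Markov property at the first visit to `A`. -/
lemma neverProb_le_add_avoidProb (hN : 0 < N) {A B : Set ℂ} {s t : ℝ} (ht : 0 ≤ t)
    (hs : ∀ y ∈ stepLattice N a, neverProb N a B y ≤ s)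
    (hA : ∀ y ∈ stepLattice N a, y ∈ A → neverProb N a B y ≤ t) (n : ℕ) :
    ∀ y ∈ stepLattice N a, neverProb N a B y ≤ t + s * avoidProb N a A n y := by
  induction n with
  | zero =>
    intro y hy
    by_cases h : y ∈ A
    · simpa [avoidProb_of_mem h] using hA y hy h
    · rw [avoidProb_zero_of_notMem h]
      linarith [hs y hy]
  | succ n ih =>
    intro y hy
    by_cases h : y ∈ A
    · simpa [avoidProb_of_mem h] using hA y hy h
    · rw [avoidProb_succ_of_notMem h]
      refine (neverProb_le_stepMean hN y).trans ((stepMean_mono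
        (h := fun z => t + s * avoidProb N a A n z)
        fun k hk => ih _ (add_mem hy (stepPoint_mem_stepLattice hk))).trans_eq ?_)
      rw [stepMean_add, stepMean_const hN, stepMean_const_mul]

/-- From all lattice points of a bounded set, the walk reaches a given ball around a lattice point
with probability bounded below: by total boundedness, finitely many lists of steps suffice. -/
lemma exists_neverProb_le_of_isBounded (hN : 2 ≤ N) {A : Set ℂ} (hA : Bornology.IsBounded A)
    {x : ℂ} (hx : x ∈ stepLattice N a) {ε : ℝ} (hε : 0 < ε) :
    ∃ c < 1, 0 ≤ c ∧ ∀ s, (∀ y ∈ stepLattice N a, neverProb N a (Metric.closedBall x ε) y ≤ s) →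
      ∀ y ∈ stepLattice N a, y ∈ A → neverProb N a (Metric.closedBall x ε) y ≤ s * c := by
  have hN0 : 0 < N := by omega
  obtain ⟨t, ht, htf, hcov⟩ := Metric.finite_approx_of_totallyBounded
    ((Metric.isBounded_iff_subset_closedBall 0).1 (hA.subset
      (Set.inter_subset_left (t := (stepLattice N a : Set ℂ)))) |>.elim fun r hr =>
        (isCompact_closedBall (0 : ℂ) r).totallyBounded.subset hr) ε hε
  have hlist : ∀ z : ℂ, ∃ l : List ℕ, z ∈ t →
      (∀ k ∈ l, k < N) ∧ (l.map (stepPoint N a)).sum = x - z := by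
    intro z
    by_cases hz : z ∈ t
    · obtain ⟨l, hl⟩ := exists_list_sum_stepPoint hN (sub_mem hx (ht hz).2)
      exact ⟨l, fun _ => hl⟩
    · exact ⟨[], fun h => absurd h hz⟩
  choose l hl using hlist
  obtain ⟨m, hm⟩ := (htf.image fun z => (l z).length).bddAbove
  have hpos : (0 : ℝ) < (N : ℝ)⁻¹ ^ m := by positivity
  have hN1 : (N : ℝ)⁻¹ ≤ 1 := inv_le_one_of_one_le₀ (by exact_mod_cast hN0)
  refine ⟨1 - (N : ℝ)⁻¹ ^ m, by linarith, by
    linarith [pow_le_one₀ (n := m) (by positivity : (0 : ℝ) ≤ (N : ℝ)⁻¹) hN1], ?_⟩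
  intro s hs y hy hyA
  have hs0 : 0 ≤ s := (neverProb_nonneg y).trans (hs y hy)
  obtain ⟨z, hz, hyz⟩ := Set.mem_iUnion₂.1 (hcov ⟨hyA, hy⟩)
  obtain ⟨hlN, hlsum⟩ := hl z hz
  refine (neverProb_le_mul_avoidProb hN0 hs (l z).length y hy).trans
    (mul_le_mul_of_nonneg_left ((avoidProb_length_le hN0 (l z) hlN ?_).trans ?_) hs0)
  · rw [hlsum, Metric.mem_closedBall, dist_eq_norm,
      show y + (x - z) - x = y - z by ring, ← dist_eq_norm]
    exact (Metric.mem_ball.1 hyz).le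
  · have : (l z).length ≤ m := hm ⟨z, hz, rfl⟩
    linarith [pow_le_pow_of_le_one (by positivity : (0 : ℝ) ≤ (N : ℝ)⁻¹) hN1 this]

/-- If the walk almost surely visits a bounded set from wherever it starts, then it almost surely
visits every ball around a lattice point. -/
theorem neverProb_closedBall_eq_zero (hN : 2 ≤ N) {A : Set ℂ} (hA : Bornology.IsBounded A)
    (hhit : ∀ y, neverProb N a A y = 0) {x : ℂ} (hx : x ∈ stepLattice N a) {ε : ℝ} (hε : 0 < ε)
    {y : ℂ} (hy : y ∈ stepLattice N a) : neverProb N a (Metric.closedBall x ε) y = 0 := by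
  have hN0 : 0 < N := by omega
  set h := neverProb N a (Metric.closedBall x ε) with hh
  obtain ⟨c, hc1, hc0, hc⟩ := exists_neverProb_le_of_isBounded hN hA hx hε
  have hbdd : BddAbove (Set.range fun z : stepLattice N a => h z) :=
    ⟨1, by rintro _ ⟨z, rfl⟩; exact neverProb_le_one hN0 _⟩
  set s := ⨆ z : stepLattice N a, h z with hs
  have hle : ∀ z ∈ stepLattice N a, h z ≤ s := fun z hz => le_ciSup hbdd ⟨z, hz⟩
  have hs0 : 0 ≤ s := (neverProb_nonneg y).trans (hle y hy)
  have hsc : s ≤ s * c := by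
    refine ciSup_le fun z => ?_
    have h1 : Tendsto (fun n => s * c + s * avoidProb N a A n z) atTop
        (nhds (s * c + s * neverProb N a A z)) :=
      ((tendsto_avoidProb hN0 _).const_mul _).const_add _
    rw [hhit, mul_zero, add_zero] at h1
    exact ge_of_tendsto h1 (Eventually.of_forall fun n =>
      neverProb_le_add_avoidProb hN0 (mul_nonneg hs0 hc0) hle (hc s hle) n z z.2)
  -- `s ≤ s * c` with `c < 1`
  have hs1 : s ≤ 0 := by nlinarith
  exact le_antisymm ((hle y hy).trans hs1) (neverProb_nonneg y)

end Recurrence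

/-! ### The Lyapunov function `log ‖y‖² - ‖y‖⁻²` -/

section LogPotential

variable {N : ℕ}

lemma prod_add_stepPoint_one (hN : 0 < N) (y : ℂ) :
    ∏ k ∈ Finset.range N, (y + stepPoint N 1 k) = y ^ N - (-1) ^ N := by
  have hζ := Complex.isPrimitiveRoot_exp N hN.ne'
  rw [hζ.pow_sub_pow_eq_prod_sub_mul y (-1) hN]
  have h : (Polynomial.nthRootsFinset N (1 : ℂ)).val = (Multiset.range N).map
      (fun k => Complex.exp (2 * Real.pi * Complex.I / N) ^ k) := by
    have := hζ.nthRoots_eq (α := 1) (a := 1) (one_pow N)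
    rw [Polynomial.nthRootsFinset, Multiset.toFinset_val, Multiset.dedup_eq_self.2
      (hζ.nthRoots_one_nodup), this]
    simp
  rw [Finset.prod_eq_multiset_prod, Finset.prod_eq_multiset_prod, h, Multiset.map_map]
  simp [stepPoint_eq_mul_pow]

lemma sum_stepPoint_one_sq (hN : 3 ≤ N) : ∑ k ∈ Finset.range N, stepPoint N 1 k ^ 2 = 0 := by
  have hζ := Complex.isPrimitiveRoot_exp N (by omega)
  have h2 : Complex.exp (2 * Real.pi * Complex.I / N) ^ 2 ≠ 1 :=
    hζ.pow_ne_one_of_pos_of_lt (by omega) (by omega)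
  have h : ∀ k, stepPoint N 1 k ^ 2 = (Complex.exp (2 * Real.pi * Complex.I / N) ^ 2) ^ k := by
    intro k
    rw [stepPoint_eq_mul_pow, one_mul, pow_right_comm]
  simp only [h]
  rw [geom_sum_eq h2, pow_right_comm, hζ.pow_eq_one]
  simp

lemma norm_add_stepPoint_one_sq (y : ℂ) (k : ℕ) :
    ‖y + stepPoint N 1 k‖ ^ 2 =
      ‖y‖ ^ 2 + (2 * ((starRingEnd ℂ) y * stepPoint N 1 k).re + 1) := by
  have h := norm_stepPoint N 1 k
  have h1 : ‖stepPoint N 1 k‖ ^ 2 = 1 := by rw [h]; simp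
  rw [Complex.sq_norm, Complex.normSq_apply] at h1 ⊢
  rw [Complex.sq_norm, Complex.normSq_apply]
  simp only [Complex.add_re, Complex.add_im, Complex.mul_re, Complex.conj_re, Complex.conj_im]
  linear_combination h1

lemma sum_re_conj_mul_stepPoint_one (hN : 2 ≤ N) (y : ℂ) :
    ∑ k ∈ Finset.range N, ((starRingEnd ℂ) y * stepPoint N 1 k).re = 0 := by
  rw [← Complex.re_sum, ← Finset.mul_sum, sum_stepPoint hN]
  simp

/-- The covariance of a step is half the identity. -/
lemma sum_re_conj_mul_stepPoint_one_sq (hN : 3 ≤ N) (y : ℂ) :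
    ∑ k ∈ Finset.range N, ((starRingEnd ℂ) y * stepPoint N 1 k).re ^ 2 = N * ‖y‖ ^ 2 / 2 := by
  have h : ∀ w : ℂ, w.re ^ 2 = ‖w‖ ^ 2 / 2 + (w ^ 2).re / 2 := by
    intro w
    rw [Complex.sq_norm, Complex.normSq_apply, pow_two w, Complex.mul_re]
    ring
  simp only [h, Finset.sum_add_distrib, ← Finset.sum_div, ← Complex.re_sum, mul_pow,
    ← Finset.mul_sum, sum_stepPoint_one_sq hN]
  simp [norm_stepPoint]

lemma abs_re_conj_mul_stepPoint_one_le (y : ℂ) (k : ℕ) :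
    |((starRingEnd ℂ) y * stepPoint N 1 k).re| ≤ ‖y‖ := by
  refine (Complex.abs_re_le_norm _).trans ?_
  simp [norm_stepPoint]

/-- The logarithm is harmonic for the walk up to an error of order `‖y‖ ^ (-N)`, because the
product of the `y + e^{2πik/N}` is `y ^ N ± 1`. -/
lemma stepMean_log_le (hN : 5 ≤ N) {y : ℂ} (hy : 2 ≤ ‖y‖) :
    stepMean N 1 (fun z => 2 * Real.log ‖z‖) y ≤ 2 * Real.log ‖y‖ + ‖y‖⁻¹ ^ 5 := by
  have hpos : 0 < ‖y‖ := by linarith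
  have hNr : (5 : ℝ) ≤ N := by exact_mod_cast hN
  have hne : ∀ k ∈ Finset.range N, ‖y + stepPoint N 1 k‖ ≠ 0 := by
    intro k _ h
    have := norm_sub_le (y + stepPoint N 1 k) (stepPoint N 1 k)
    rw [add_sub_cancel_right, norm_stepPoint, h, norm_one] at this
    linarith
  have h1 : ∑ k ∈ Finset.range N, Real.log ‖y + stepPoint N 1 k‖
      = Real.log ‖y ^ N - (-1) ^ N‖ := by
    rw [← prod_add_stepPoint_one (by omega), norm_prod, Real.log_prod hne]
  have h2 : ‖y ^ N - (-1) ^ N‖ ≤ ‖y‖ ^ N * (1 + ‖y‖⁻¹ ^ N) := by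
    refine (norm_sub_le _ _).trans_eq ?_
    rw [norm_pow, norm_pow, norm_neg, norm_one, one_pow, mul_add, ← mul_pow,
      mul_inv_cancel₀ hpos.ne', one_pow, mul_one]
  have h0 : 0 < ‖y ^ N - (-1) ^ N‖ := by
    rw [← prod_add_stepPoint_one (by omega), norm_prod]
    exact Finset.prod_pos fun k hk => lt_of_le_of_ne (norm_nonneg _) (hne k hk).symm
  have h3 : Real.log ‖y ^ N - (-1) ^ N‖ ≤ N * Real.log ‖y‖ + ‖y‖⁻¹ ^ 5 := by
    refine (Real.log_le_log h0 h2).trans ?_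
    rw [Real.log_mul (by positivity) (by positivity), Real.log_pow]
    have h4 := Real.log_le_sub_one_of_pos (by positivity : 0 < 1 + ‖y‖⁻¹ ^ N)
    have h5 : ‖y‖⁻¹ ^ N ≤ ‖y‖⁻¹ ^ 5 :=
      pow_le_pow_of_le_one (by positivity) (inv_le_one_of_one_le₀ (by linarith)) hN
    linarith
  rw [stepMean, ← Finset.mul_sum, h1, inv_mul_le_iff₀ (by positivity)]
  have : 0 ≤ ‖y‖⁻¹ ^ 5 := by positivity
  nlinarith

/-- The function `‖·‖⁻²` is subharmonic for the walk, with a drift of order `‖y‖⁻⁴` that comes from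
the second-order term of `1 / (1 + s) ≥ 1 - s + s² - s³`. -/
lemma le_stepMean_inv_norm_sq (hN : 3 ≤ N) {y : ℂ} (hy : 2 ≤ ‖y‖) :
    (‖y‖⁻¹) ^ 2 + (‖y‖⁻¹) ^ 4 - 27 * (‖y‖⁻¹) ^ 5 ≤ stepMean N 1 (fun z => (‖z‖ ^ 2)⁻¹) y := by
  set r := ‖y‖⁻¹ with hr
  have hpos : 0 < ‖y‖ := by linarith
  have hr0 : 0 < r := inv_pos.2 hpos
  have hr1 : r ≤ 1 := inv_le_one_of_one_le₀ (by linarith)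
  have hyr : ‖y‖ * r = 1 := mul_inv_cancel₀ hpos.ne'
  set b : ℕ → ℝ := fun k => ((starRingEnd ℂ) y * stepPoint N 1 k).re with hb
  have hNr : (0 : ℝ) < N := by exact_mod_cast (by omega : 0 < N)
  have key : ∀ k ∈ Finset.range N,
      r ^ 2 * (1 - r ^ 2 * (2 * b k + 1) + r ^ 4 * (4 * b k ^ 2 + 4 * b k + 1) - 27 * r ^ 3)
        ≤ (‖y + stepPoint N 1 k‖ ^ 2)⁻¹ := by
    intro k _
    have hbk : |b k * r| ≤ 1 := by
      rw [abs_mul, abs_of_pos hr0, ← hyr]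
      exact mul_le_mul_of_nonneg_right (abs_re_conj_mul_stepPoint_one_le y k) hr0.le
    obtain ⟨hb1, hb2⟩ := abs_le.1 hbk
    set s := r ^ 2 * (2 * b k + 1) with hs
    have hs_eq : s = r * (2 * (b k * r) + r) := by rw [hs]; ring
    have hs3 : s ^ 3 ≤ 27 * r ^ 3 := by
      have h1 : s ≤ 3 * r := by rw [hs_eq]; nlinarith
      have h3 : s ^ 3 ≤ (3 * r) ^ 3 := (show Odd 3 by decide).strictMono_pow.monotone h1
      linarith [h3, (by ring : (3 * r) ^ 3 = 27 * r ^ 3)]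
    have hnorm : ‖y + stepPoint N 1 k‖ ^ 2 * r ^ 2 = 1 + s := by
      rw [norm_add_stepPoint_one_sq, add_mul, ← mul_pow, hyr, hs]
      ring
    have hge : 1 ≤ ‖y + stepPoint N 1 k‖ := by
      have := norm_sub_le (y + stepPoint N 1 k) (stepPoint N 1 k)
      rw [add_sub_cancel_right, norm_stepPoint, norm_one] at this
      linarith
    have hs1 : 0 < 1 + s := by rw [← hnorm]; positivity
    have hinv : (‖y + stepPoint N 1 k‖ ^ 2)⁻¹ = r ^ 2 * (1 + s)⁻¹ := by
      rw [← hnorm]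
      field_simp
    rw [hinv]
    refine mul_le_mul_of_nonneg_left ?_ (by positivity)
    have h4 : 1 - s + s ^ 2 - s ^ 3 ≤ (1 + s)⁻¹ := by
      rw [← one_div, le_div_iff₀ hs1]
      nlinarith [sq_nonneg (s ^ 2)]
    have h5 : s ^ 2 = r ^ 4 * (4 * b k ^ 2 + 4 * b k + 1) := by rw [hs]; ring
    linarith
  have hsum := Finset.sum_le_sum key
  have hb1 : ∑ k ∈ Finset.range N, b k = 0 := sum_re_conj_mul_stepPoint_one (by omega) y
  have hb2 : ∑ k ∈ Finset.range N, b k ^ 2 = N * ‖y‖ ^ 2 / 2 :=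
    sum_re_conj_mul_stepPoint_one_sq hN y
  rw [← Finset.mul_sum, Finset.sum_sub_distrib, Finset.sum_add_distrib, Finset.sum_sub_distrib,
    ← Finset.mul_sum, ← Finset.mul_sum, Finset.sum_add_distrib, Finset.sum_add_distrib,
    Finset.sum_add_distrib, ← Finset.mul_sum, ← Finset.mul_sum, ← Finset.mul_sum, hb1, hb2] at hsum
  simp only [Finset.sum_const, Finset.card_range, nsmul_eq_mul, mul_zero, zero_add, add_zero,
    mul_one] at hsum
  rw [stepMean, ← div_eq_inv_mul, le_div_iff₀ hNr]
  refine le_trans ?_ hsum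
  have h6 : r ^ 4 * (4 * (N * ‖y‖ ^ 2 / 2)) = 2 * N * r ^ 2 := by
    linear_combination 2 * N * r ^ 2 * (‖y‖ * r + 1) * hyr
  have h7 : 0 ≤ N * r ^ 6 := by positivity
  nlinarith

/-- The Lyapunov function `log ‖y‖² - ‖y‖⁻²`, replaced by `0` near the origin to make it nonnegative.
The radius `99` leaves room for a step of length `1` from a point with `100 < ‖y‖`, where the drift
estimate is used. -/
noncomputable def logPotential (y : ℂ) : ℝ :=
  if 99 ≤ ‖y‖ then 2 * Real.log ‖y‖ - (‖y‖ ^ 2)⁻¹ else 0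

lemma logPotential_nonneg (y : ℂ) : 0 ≤ logPotential y := by
  unfold logPotential
  split_ifs with h
  · have h1 := Real.one_sub_inv_le_log_of_pos (by linarith : 0 < ‖y‖)
    have h2 : ‖y‖⁻¹ ≤ 2⁻¹ := inv_anti₀ (by norm_num) (by linarith)
    have h3 : (‖y‖ ^ 2)⁻¹ ≤ 1 := inv_le_one_of_one_le₀ (by nlinarith)
    linarith
  · exact le_rfl

/-- The drift `-‖y‖⁻⁴` of `-‖·‖⁻²` outweighs the errors of order `‖y‖⁻⁵`. -/
lemma stepMean_logPotential_le (hN : 5 ≤ N) {y : ℂ} (hy : 100 < ‖y‖) :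
    stepMean N 1 logPotential y ≤ logPotential y - (‖y‖⁻¹) ^ 4 / 2 := by
  have h1 : stepMean N 1 logPotential y
      ≤ stepMean N 1 (fun z => 2 * Real.log ‖z‖ + (-1) * (‖z‖ ^ 2)⁻¹) y := by
    refine stepMean_mono fun k _ => ?_
    have := norm_sub_le (y + stepPoint N 1 k) (stepPoint N 1 k)
    rw [add_sub_cancel_right, norm_stepPoint, norm_one] at this
    rw [logPotential, if_pos (by linarith)]
    linarith
  rw [stepMean_add, stepMean_const_mul (-1)] at h1
  have h2 := stepMean_log_le hN (y := y) (by linarith)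
  have h3 := le_stepMean_inv_norm_sq (N := N) (by omega) (y := y) (by linarith)
  rw [logPotential, if_pos (by linarith), ← inv_pow]
  have h4 : ‖y‖⁻¹ ≤ 100⁻¹ := inv_anti₀ (by norm_num) hy.le
  have h5 : (‖y‖⁻¹) ^ 5 ≤ (‖y‖⁻¹) ^ 4 * 100⁻¹ := by rw [pow_succ]; gcongr
  have h6 : 0 ≤ (‖y‖⁻¹) ^ 4 := by positivity
  linarith

lemma norm_le_exp_of_logPotential_lt {y : ℂ} (hy : 100 < ‖y‖) {M : ℝ} (h : logPotential y < M) :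
    ‖y‖ ≤ Real.exp (M + 1) := by
  rw [logPotential, if_pos (by linarith)] at h
  have h1 : (‖y‖ ^ 2)⁻¹ ≤ 1 := inv_le_one_of_one_le₀ (by nlinarith)
  have h2 := Real.log_nonneg (by linarith : 1 ≤ ‖y‖)
  rw [← Real.log_le_iff_le_exp (by linarith)]
  linarith

/-- The walk visits the disc of radius `100 ‖a‖` almost surely, from wherever it starts. -/
theorem neverProb_norm_div_le_eq_zero (hN : 5 ≤ N) {a : ℂ} (ha : a ≠ 0) (x : ℂ) :
    neverProb N a {y | ‖y / a‖ ≤ 100} x = 0 := by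
  have hscale : ∀ y, stepMean N a (fun z => logPotential (z / a)) y
      = stepMean N 1 logPotential (y / a) := by
    intro y
    simp only [stepMean, stepPoint_eq_mul_pow, add_div, mul_div_cancel_left₀ _ ha, one_mul]
  refine neverProb_eq_zero_of_lyapunov (f := fun z => logPotential (z / a)) (by omega)
    (fun _ => logPotential_nonneg _) (fun y hy => ?_) (fun M => ?_) x
  · rw [hscale]
    have h := stepMean_logPotential_le hN (not_le.1 hy : 100 < ‖y / a‖)
    have : 0 ≤ (‖y / a‖⁻¹) ^ 4 := by positivity
    linarith
  · refine ⟨((Real.exp (M + 1))⁻¹) ^ 4 / 2, by positivity, fun y hy hM => ?_⟩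
    rw [hscale]
    have hy' : 100 < ‖y / a‖ := not_le.1 hy
    refine (stepMean_logPotential_le hN hy').trans ?_
    have h0 : 0 < ‖y / a‖ := by linarith
    gcongr
    exact norm_le_exp_of_logPotential_lt hy' hM

/-- The walk started in the lattice almost surely visits every ball around a lattice point. -/
theorem neverProb_closedBall_stepLattice (hN : 5 ≤ N) (a : ℂ) {x y : ℂ} (hx : x ∈ stepLattice N a)
    (hy : y ∈ stepLattice N a) {ε : ℝ} (hε : 0 < ε) :
    neverProb N a (Metric.closedBall x ε) y = 0 := by
  rcases eq_or_ne a 0 with rfl | ha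
  · have hbot : stepLattice N 0 ≤ ⊥ := by
      rw [stepLattice, AddSubgroup.closure_le]
      rintro _ ⟨k, _, rfl⟩
      simp [stepPoint]
    have hx' : x = 0 := hbot hx
    have hy' : y = 0 := hbot hy
    exact neverProb_of_mem (by simp [hx', hy', hε.le])
  · refine neverProb_closedBall_eq_zero (by omega) ?_ (neverProb_norm_div_le_eq_zero hN ha) hx hε hy
    refine (Metric.isBounded_closedBall (x := (0 : ℂ)) (r := 100 * ‖a‖)).subset fun y hy => ?_
    rw [mem_closedBall_zero_iff, ← div_le_iff₀ (norm_pos_iff.2 ha), ← norm_div]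
    exact hy

end LogPotential

/-! ### The law of the step sequence and the avoidance events -/

section PathLaw

variable {N : ℕ} {a : ℂ}

lemma isProbabilityMeasure_stepLaw (hN : 0 < N) (a : ℂ) : IsProbabilityMeasure (stepLaw N a) := by
  constructor
  simp only [stepLaw, Measure.smul_apply, Measure.finsetSum_apply, measure_univ, Finset.sum_const,
    Finset.card_range, smul_eq_mul, nsmul_eq_mul, mul_one]
  exact ENNReal.inv_mul_cancel (by simpa using hN.ne') (ENNReal.natCast_ne_top N)

lemma lintegral_stepLaw (g : ℂ → ℝ≥0∞) :
    ∫⁻ z, g z ∂stepLaw N a = (N : ℝ≥0∞)⁻¹ * ∑ k ∈ Finset.range N, g (stepPoint N a k) := by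
  simp [stepLaw, lintegral_smul_measure, lintegral_finsetSum_measure]

/-- The law of a sequence of independent steps. -/
noncomputable def pathLaw (N : ℕ) (a : ℂ) : Measure (ℕ → ℂ) :=
  Measure.infinitePi fun _ => stepLaw N a

lemma isProbabilityMeasure_pathLaw (hN : 0 < N) (a : ℂ) : IsProbabilityMeasure (pathLaw N a) := by
  have := isProbabilityMeasure_stepLaw hN a
  unfold pathLaw
  infer_instance

/-- The first step is independent of the later ones, and these again have the law `pathLaw N a`. -/
lemma pathLaw_map_head_tail (hN : 0 < N) (a : ℂ) :
    (pathLaw N a).map (fun t => (t 0, fun i => t (i + 1))) = (stepLaw N a).prod (pathLaw N a) := by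
  have := isProbabilityMeasure_stepLaw hN a
  have := isProbabilityMeasure_pathLaw hN a
  have hind : iIndepFun (fun (i : ℕ) (t : ℕ → ℂ) => t i) (pathLaw N a) :=
    iIndepFun_infinitePi (P := fun _ : ℕ => stepLaw N a) (X := fun _ z => z) fun _ => measurable_id
  have h01 : IndepFun (fun t : ℕ → ℂ => t 0) (fun t i => t (i + 1)) (pathLaw N a) := by
    have h := indep_iSup_of_disjoint (fun i => (measurable_pi_apply i).comap_le) hind
      (S := {0}) (T := {0}ᶜ) disjoint_compl_right
    rw [iSup_singleton] at h
    refine indep_of_indep_of_le_right h ?_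
    simp only [MeasurableSpace.pi, MeasurableSpace.comap_iSup, MeasurableSpace.comap_comp]
    exact iSup_le fun i => le_iSup₂_of_le
      (f := fun (i : ℕ) (_ : i ∈ ({0}ᶜ : Set ℕ)) => MeasurableSpace.comap (fun t : ℕ → ℂ => t i) _)
      (i + 1) (by simp) le_rfl
  rw [(indepFun_iff_map_prod_eq_prod_map_map (Measurable.aemeasurable (by fun_prop))
    (Measurable.aemeasurable (by fun_prop))).1 h01]
  congr 1
  · exact Measure.infinitePi_map_eval (fun _ : ℕ => stepLaw N a) 0
  · exact Measure.map_infinitePi_infinitePi_of_inj (P := fun _ : ℕ => stepLaw N a)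
      (f := fun i => i + 1) (add_left_injective 1)

lemma pathLaw_head_tail_apply (hN : 0 < N) (a : ℂ) {G : Set (ℂ × (ℕ → ℂ))}
    (hG : MeasurableSet G) :
    pathLaw N a {t | (t 0, fun i => t (i + 1)) ∈ G} =
      (N : ℝ≥0∞)⁻¹ * ∑ k ∈ Finset.range N, pathLaw N a {t | (stepPoint N a k, t) ∈ G} := by
  have := isProbabilityMeasure_stepLaw hN a
  have := isProbabilityMeasure_pathLaw hN a
  have h : pathLaw N a {t | (t 0, fun i => t (i + 1)) ∈ G} =
      (pathLaw N a).map (fun t => (t 0, fun i => t (i + 1))) G :=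
    (Measure.map_apply (by fun_prop) hG).symm
  rw [h, pathLaw_map_head_tail hN, Measure.prod_apply hG, lintegral_stepLaw]
  rfl

/-- The event that the walk started at `y` avoids `B` at the times `m, …, m + j`. -/
def avoidEvent (B : Set ℂ) (m j : ℕ) (y : ℂ) : Set (ℕ → ℂ) :=
  {t | ∀ i ≤ j, y + ∑ l ∈ Finset.range (m + i), t l ∉ B}

lemma measurableSet_avoidEvent {B : Set ℂ} (hB : MeasurableSet B) (m j : ℕ) :
    MeasurableSet {p : ℂ × (ℕ → ℂ) | p.2 ∈ avoidEvent B m j p.1} := by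
  have : {p : ℂ × (ℕ → ℂ) | p.2 ∈ avoidEvent B m j p.1} =
      ⋂ i ∈ Finset.range (j + 1),
        (fun p : ℂ × (ℕ → ℂ) => p.1 + ∑ l ∈ Finset.range (m + i), p.2 l) ⁻¹' Bᶜ := by
    ext p
    simp [avoidEvent]
  rw [this]
  refine Finset.measurableSet_biInter _ fun i _ => ?_
  exact (by fun_prop : Measurable fun p : ℂ × (ℕ → ℂ) =>
    p.1 + ∑ l ∈ Finset.range (m + i), p.2 l) hB.compl

/-- Conditioning an avoidance event on the first step. -/
lemma pathLaw_avoidEvent_tail (hN : 0 < N) (a : ℂ) {B : Set ℂ} (hB : MeasurableSet B) (m j : ℕ)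
    (y : ℂ) {g : ℂ → ℝ} (hg : ∀ z, 0 ≤ g z)
    (h : ∀ z, pathLaw N a (avoidEvent B m j z) = ENNReal.ofReal (g z)) :
    pathLaw N a {t | (fun i => t (i + 1)) ∈ avoidEvent B m j (y + t 0)} =
      ENNReal.ofReal (stepMean N a g y) := by
  have hG : MeasurableSet {p : ℂ × (ℕ → ℂ) | p.2 ∈ avoidEvent B m j (y + p.1)} :=
    (by fun_prop : Measurable fun p : ℂ × (ℕ → ℂ) => (y + p.1, p.2))
      (measurableSet_avoidEvent hB m j)
  refine (pathLaw_head_tail_apply hN a hG).trans ?_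
  have h' : ∀ k, pathLaw N a {t | (stepPoint N a k, t) ∈
      {p : ℂ × (ℕ → ℂ) | p.2 ∈ avoidEvent B m j (y + p.1)}} =
      ENNReal.ofReal (g (y + stepPoint N a k)) := fun k => h (y + stepPoint N a k)
  simp only [h', stepMean]
  rw [ENNReal.ofReal_mul (by positivity), ENNReal.ofReal_sum_of_nonneg fun _ _ => hg _,
    ENNReal.ofReal_inv_of_pos (by exact_mod_cast hN), ENNReal.ofReal_natCast]

lemma mem_avoidEvent_succ (B : Set ℂ) (m j : ℕ) (y : ℂ) (t : ℕ → ℂ) :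
    t ∈ avoidEvent B (m + 1) j y ↔ (fun i => t (i + 1)) ∈ avoidEvent B m j (y + t 0) := by
  refine forall₂_congr fun i _ => ?_
  rw [show m + 1 + i = m + i + 1 by omega, Finset.sum_range_succ', add_assoc,
    add_comm (t 0)]

lemma mem_avoidEvent_zero_succ (B : Set ℂ) (j : ℕ) (y : ℂ) (t : ℕ → ℂ) :
    t ∈ avoidEvent B 0 (j + 1) y ↔ y ∉ B ∧ t ∈ avoidEvent B 1 j y := by
  constructor
  · intro h
    refine ⟨by simpa using h 0 (by omega), fun i hi => ?_⟩
    simpa [add_comm] using h (i + 1) (by omega)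
  · rintro ⟨h0, h⟩ i hi
    rcases i with _ | i
    · simpa using h0
    · simpa [add_comm] using h i (by omega)

/-- `avoidProb` is the probability of avoiding `B` from time `0` on. -/
lemma pathLaw_avoidEvent_zero (hN : 0 < N) (a : ℂ) {B : Set ℂ} (hB : MeasurableSet B) (j : ℕ)
    (y : ℂ) : pathLaw N a (avoidEvent B 0 j y) = ENNReal.ofReal (avoidProb N a B j y) := by
  have := isProbabilityMeasure_pathLaw hN a
  induction j generalizing y with
  | zero => by_cases hy : y ∈ B <;> simp [avoidEvent, avoidProb, hy]
  | succ j ih =>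
    have h1 : avoidEvent B 0 (j + 1) y =
        {t | y ∉ B ∧ (fun i => t (i + 1)) ∈ avoidEvent B 0 j (y + t 0)} := by
      ext t
      exact (mem_avoidEvent_zero_succ B j y t).trans
        (and_congr_right fun _ => mem_avoidEvent_succ B 0 j y t)
    rw [h1]
    by_cases hy : y ∈ B
    · simp [hy, avoidProb]
    · rw [avoidProb_succ_of_notMem hy]
      simpa [hy] using pathLaw_avoidEvent_tail hN a hB 0 j y (avoidProb_nonneg j) ih

/-- The walk started in the lattice almost surely visits any ball around a lattice point after any
given time `m`: the Markov property at time `m` reduces this to the case `m = 0`. -/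
lemma tendsto_pathLaw_avoidEvent (hN : 5 ≤ N) (a : ℂ) {x : ℂ} (hx : x ∈ stepLattice N a) {ε : ℝ}
    (hε : 0 < ε) (m : ℕ) : ∀ y ∈ stepLattice N a, Tendsto
      (fun j => pathLaw N a (avoidEvent (Metric.closedBall x ε) m j y)) atTop (nhds 0) := by
  have hN0 : 0 < N := by omega
  have hB : MeasurableSet (Metric.closedBall x ε) := measurableSet_closedBall
  induction m with
  | zero =>
    intro y hy
    simp only [pathLaw_avoidEvent_zero hN0 a hB]
    rw [← ENNReal.ofReal_zero, ← neverProb_closedBall_stepLattice hN a hx hy hε]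
    exact ENNReal.tendsto_ofReal (tendsto_avoidProb hN0 y)
  | succ m ih =>
    intro y hy
    have := isProbabilityMeasure_pathLaw hN0 a
    have h1 : ∀ j, pathLaw N a (avoidEvent (Metric.closedBall x ε) (m + 1) j y) =
        ENNReal.ofReal (stepMean N a
          (fun z => (pathLaw N a (avoidEvent (Metric.closedBall x ε) m j z)).toReal) y) := by
      intro j
      rw [← pathLaw_avoidEvent_tail hN0 a hB m j y (fun _ => ENNReal.toReal_nonneg)
        fun z => (ENNReal.ofReal_toReal (measure_ne_top _ _)).symm]
      congr 1
      ext t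
      exact mem_avoidEvent_succ _ m j y t
    simp only [h1]
    rw [← ENNReal.ofReal_zero]
    refine ENNReal.tendsto_ofReal ?_
    have h2 : Tendsto (fun j => stepMean N a
        (fun z => (pathLaw N a (avoidEvent (Metric.closedBall x ε) m j z)).toReal) y) atTop
        (nhds ((N : ℝ)⁻¹ * ∑ k ∈ Finset.range N, (0 : ℝ≥0∞).toReal)) :=
      (tendsto_finsetSum _ fun k hk => (ENNReal.tendsto_toReal ENNReal.zero_ne_top).comp
        (ih _ (add_mem hy (stepPoint_mem_stepLattice (Finset.mem_range.1 hk))))).const_mul _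
    simpa using h2

lemma pathLaw_ae_frequently (hN : 5 ≤ N) (a : ℂ) {x : ℂ} (hx : x ∈ stepLattice N a) {ε : ℝ}
    (hε : 0 < ε) :
    ∀ᵐ t ∂pathLaw N a, ∀ m, ∃ n ≥ m, ‖∑ l ∈ Finset.range n, t l - x‖ ≤ ε := by
  refine ae_all_iff.2 fun m => ?_
  rw [ae_iff]
  -- Never being in the ball from time `m` on implies every event `avoidEvent _ m j 0`.
  refine le_antisymm (ge_of_tendsto' (tendsto_pathLaw_avoidEvent hN a hx hε m 0 (zero_mem _))
    fun j => measure_mono fun t ht => ?_) zero_le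
  intro i _ hi
  refine ht ⟨m + i, Nat.le_add_right m i, ?_⟩
  simpa [dist_eq_norm] using hi

end PathLaw

theorem mainTheorem7 {Ω : Type*} [MeasurableSpace Ω] (P : Measure Ω) [IsProbabilityMeasure P]
    (N : ℕ) (hN : 5 ≤ N) (α a : ℂ) (ha : a ^ N = α)
    (ξ : ℕ → Ω → ℂ) (hlaw : ∀ j, HasLaw (ξ j) (stepLaw N a) P) (hindep : iIndepFun ξ P) :
    ∀ x ∈ stepLattice N a, ∀ ε : ℝ, 0 < ε →
      P {ω | ∃ᶠ n in atTop, ‖walk ξ n ω - x‖ ≤ ε} = 1 := by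
  intro x hx ε hε
  have hmeas : AEMeasurable (fun ω i => ξ i ω) P :=
    aemeasurable_pi_iff.2 fun i => (hlaw i).aemeasurable
  have hmap : P.map (fun ω i => ξ i ω) = pathLaw N a :=
    (hindep.hasLaw_infinitePi hlaw hmeas).map_eq
  have h := pathLaw_ae_frequently hN a hx hε
  rw [← hmap] at h
  have h' : {ω | ∃ᶠ n in atTop, ‖walk ξ n ω - x‖ ≤ ε} ∈ ae P := by
    filter_upwards [ae_of_ae_map hmeas h] with ω hω
    exact frequently_atTop.2 hω
  exact (measure_congr (eventuallyEq_univ.2 h')).trans measure_univ
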